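/- **Setting.** Let $N=\{1,\dots,n\}$ be a set of countries. A network $g$ is a simple graph on $N$, whose edges $ij$ are alliances; $N_i(g)$ is the set of allies of $i$, and $g+jk$, $g-jk$ denote $g$ with the alliance $jk$ added, respectively deleted. A clique of $g$ is a set of countries that are pairwise allied (one-element sets are cliques). Each $C\subseteq N$ has a military strength $M(C)\ge 0$, with $M(C)\le M(D)$ whenever $C\subseteq D$; write $M_i=M(\{i\})$. For $C,C'\subseteq N$ there is a number $\gamma(C,C')>0$, with $\gamma(D,D')\le\gamma(C,C')$ whenever $C\subseteq D$ and $D'\subseteq C'$. An attack of $C$ on $C'$ is won by $C$ if $M(C)>\gamma(C,C')M(C')$. * Country $i$ is *NC-vulnerable* at $g$ if there are $j$ and $C\subseteq\{j\}\cup N_j(g)$ with $j\in C$, $i\notin C$ such that $M(C)>\gamma(C,C')M(C')$ for every clique $C'$ of $g$ with $i\in C'\subseteq\{i\}\cup (N_i(g)\setminus C)$. * Country $i$ is *CN-vulnerable* at $g$ if there is a nonempty clique $C$ of $g$ with $i\notin C$ such that $M(C)>\gamma(C,C')M(C')$ for $C'=\{i\}\cup (N_i(g)\setminus C)$. For either notion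 (XY standing for NC or CN), $g$ is *XY-war-stable* if no country is XY-vulnerable at $g$; for all $jk\notin g$ with $j\neq k$ no country is XY-vulnerable at $g+jk$; and for all $jk\in g$ both $j$ and $k$ are XY-vulnerable at $g-jk$. **Theorem 2.** Let $n\ge 3$. * **NC-vulnerability.** There are no nonempty NC-war-stable networks. The empty network is NC-war-stable if and only if $M(\{j,k\})\le\gamma(\{j,k\},\{i\})M_i$ for all distinct $i,j,k$. * **CN-vulnerability.** Suppose that $M(C)=\sum_{i\in C}M_i$ with $M_i=\bar M>0$ for all $i$, and that $\gamma(C,C')=\gamma$ is a positive constant. If $1\le\gamma<2$, then there are no CN-war-stable networks. If $\gamma\ge2$, then the empty network is the unique CN-war-stable network. If $0<\gamma<1$, then there is $n_0$, depending only on $\gamma$, such that for every $n\ge n_0$ there exists a nonempty CN-war-stable network. -/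

import Mathlib

namespace AllianceNetwork

/-- The allies `N_i(g)` of country `i` in the network `g`, as a finite set. -/
noncomputable def allies {V : Type*} [Fintype V] (g : SimpleGraph V) (i : V) : Finset V :=
  open Classical in Finset.univ.filter (fun j => g.Adj i j)

/-- The network `g + jk`, with the alliance `jk` added. -/
def addAlliance {V : Type*} (g : SimpleGraph V) (j k : V) : SimpleGraph V :=
  g ⊔ SimpleGraph.edge j k

/-- The network `g - jk`, with the alliance `jk` deleted. -/
def deleteAlliance {V : Type*} (g : SimpleGraph V) (j k : V) : SimpleGraph V :=
  g.deleteEdges {s(j, k)}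

/-- Standing assumptions on the collective strength `M C` of a group and on the defensive or
offensive advantage `γ C C'` when `C` attacks `C'`: strengths are nonnegative and monotone,
advantages are positive, and enlarging the attackers or shrinking the defenders does not increase
the defensive advantage. -/
structure IsWarTechnology {V : Type*} (M : Finset V → ℝ) (γ : Finset V → Finset V → ℝ) :
    Prop where
  strength_nonneg : ∀ C, 0 ≤ M C
  strength_mono : ∀ C D, C ⊆ D → M C ≤ M D
  advantage_pos : ∀ C C', 0 < γ C C'
  advantage_antitone : ∀ C C' D D', C ⊆ D → D' ⊆ C' → γ D D' ≤ γ C C'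

/-- The aggressors `C` win a war against the defenders `C'`. -/
def Wins {V : Type*} (M : Finset V → ℝ) (γ : Finset V → Finset V → ℝ) (C C' : Finset V) : Prop :=
  γ C C' * M C' < M C

/-- Country `i` is NC-vulnerable at `g`: a coalition `C`, consisting of some country `j` and some
of its allies, with `i ∉ C`, wins against every clique that can defend `i`, that is, every clique
that consists of `i` and some of its allies outside `C`. -/
def NCVulnerable {V : Type*} [Fintype V] [DecidableEq V] (M : Finset V → ℝ)
    (γ : Finset V → Finset V → ℝ) (g : SimpleGraph V) (i : V) : Prop :=
  ∃ j : V, ∃ C : Finset V, j ∈ C ∧ C ⊆ insert j (allies g j) ∧ i ∉ C ∧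
    ∀ C' : Finset V, i ∈ C' → C' ⊆ insert i (allies g i \ C) → g.IsClique (C' : Set V) →
      Wins M γ C C'

/-- Country `i` is CN-vulnerable at `g`: a nonempty clique `C` with `i ∉ C` wins against `i`
together with all its allies outside `C`. -/
def CNVulnerable {V : Type*} [Fintype V] [DecidableEq V] (M : Finset V → ℝ)
    (γ : Finset V → Finset V → ℝ) (g : SimpleGraph V) (i : V) : Prop :=
  ∃ C : Finset V, C.Nonempty ∧ g.IsClique (C : Set V) ∧ i ∉ C ∧
    Wins M γ C (insert i (allies g i \ C))

/-- War-stability of a network `g`, for a given notion of vulnerability. -/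
structure WarStable {V : Type*} (Vulnerable : SimpleGraph V → V → Prop) (g : SimpleGraph V) :
    Prop where
  /-- No country is vulnerable at `g`. -/
  not_vulnerable : ∀ i, ¬ Vulnerable g i
  /-- No country is vulnerable after an alliance is added. -/
  add_not_vulnerable : ∀ j k, j ≠ k → ¬ g.Adj j k → ∀ i, ¬ Vulnerable (addAlliance g j k) i
  /-- Deleting any alliance makes both of its members vulnerable. -/
  delete_vulnerable : ∀ j k, g.Adj j k →
    Vulnerable (deleteAlliance g j k) j ∧ Vulnerable (deleteAlliance g j k) k

/-- War-stability with respect to NC-vulnerability. -/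
def NCWarStable {V : Type*} [Fintype V] [DecidableEq V] (M : Finset V → ℝ)
    (γ : Finset V → Finset V → ℝ) (g : SimpleGraph V) : Prop :=
  WarStable (NCVulnerable M γ) g

/-- War-stability with respect to CN-vulnerability. -/
def CNWarStable {V : Type*} [Fintype V] [DecidableEq V] (M : Finset V → ℝ)
    (γ : Finset V → Finset V → ℝ) (g : SimpleGraph V) : Prop :=
  WarStable (CNVulnerable M γ) g

/-- The strength of a group as the sum of the strengths of its members. -/
def additiveStrength {V : Type*} (m : V → ℝ) (C : Finset V) : ℝ :=
  ∑ i ∈ C, m i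

end AllianceNetwork

/-! NC: suppose `ik` is an alliance and `C`, led by `l`, defeats `i` once `ik` is deleted. Let `k`
join `C`. Then `k` cannot defend `i`, so the deletion is irrelevant, and the enlarged attack wins at
`g` if `l` leads `k`, and otherwise at `g + lk`. Either outcome contradicts stability. At the empty
network the only new threat is a freshly allied pair against an isolated country.

CN, `1 ≤ γ`: only cardinalities matter. Let `K` be a maximum clique, of size `ω ≥ 2`, and let `x ∈
K` have `d` allies. The failure of the attack by `K \ x` bounds `d` below, while the attacks that
succeed after a deletion bound it above. Together they force each clique `C` that wins after the
deletion of `xj` to satisfy `|N(x) ∩ C| = |C| = ω - 1` or `|N(x) ∩ C| = ω - 2`, `|C| = ω`; the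
second case is excluded by adding an alliance. So every ally `j` of `x` is missed by a clique of
size `ω - 1` inside `N(x)`, the largest size possible there. These cliques have empty intersection,
so Hajnal's inequality gives `d ≥ 2(ω - 1)`, against `γ(d + 1 - ω) < ω - 1`. Only the empty network
survives, and a new pair threatens it exactly when `γ < 2`.

CN, `γ < 1`: in copies of `K_s □ K_s □ K_{t,t}` every vertex lies on two lines (cliques of size
`s`), and deleting an alliance leaves at least one of them free to attack. Choosing `s + t =
⌈(s-1)/γ⌉` makes this attack fail before the deletion and succeed after it. Special vertices with
`2p = ⌈s/γ⌉` allies, attached by subdividing edges so that other degrees do not change, adjust the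
number of countries to any large `n`. -/

namespace AllianceNetwork

/-! ### Adjacency after adding or deleting an alliance -/

section Basics

variable {V : Type*}

theorem mem_allies [Fintype V] {g : SimpleGraph V} {i v : V} : v ∈ allies g i ↔ g.Adj i v := by
  simp [allies]

theorem addAlliance_adj {g : SimpleGraph V} {j k u v : V} :
    (addAlliance g j k).Adj u v ↔ g.Adj u v ∨ (((u = j ∧ v = k) ∨ (u = k ∧ v = j)) ∧ u ≠ v) := by
  rw [addAlliance, SimpleGraph.sup_adj, SimpleGraph.edge_adj]

theorem deleteAlliance_adj {g : SimpleGraph V} {j k u v : V} :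
    (deleteAlliance g j k).Adj u v ↔ g.Adj u v ∧ ¬ ((u = j ∧ v = k) ∨ (u = k ∧ v = j)) := by
  rw [deleteAlliance, SimpleGraph.deleteEdges_adj, Set.mem_singleton_iff, Sym2.eq_iff]

theorem le_addAlliance (g : SimpleGraph V) (j k : V) : g ≤ addAlliance g j k :=
  le_sup_left

theorem deleteAlliance_le (g : SimpleGraph V) (j k : V) : deleteAlliance g j k ≤ g :=
  SimpleGraph.deleteEdges_le _

end Basics

/-! ### NC-vulnerability -/

section NC

variable {V : Type*} [Fintype V] [DecidableEq V] {M : Finset V → ℝ}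
  {γ : Finset V → Finset V → ℝ}

/-- An attack that benefits from the deletion of `ik` also succeeds, reinforced by `k`, as soon as
`k` is allied with the leader `l` of the attack. -/
theorem ncVulnerable_of_deleteAlliance (hT : IsWarTechnology M γ) {g g' : SimpleGraph V}
    {i k l : V} {C : Finset V} (hik : g.Adj i k) (hl : l ∈ C)
    (hC : C ⊆ insert l (allies (deleteAlliance g i k) l)) (hi : i ∉ C)
    (hwin : ∀ C' : Finset V, i ∈ C' → C' ⊆ insert i (allies (deleteAlliance g i k) i \ C) →
      (deleteAlliance g i k).IsClique (C' : Set V) → Wins M γ C C')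
    (hle : g ≤ g') (hg' : ∀ u v, g'.Adj u v → u ≠ l → v ≠ l → g.Adj u v)
    (hlk : l = k ∨ g'.Adj l k) : NCVulnerable M γ g' i := by
  have hne : i ≠ k := hik.ne
  refine ⟨l, insert k C, Finset.mem_insert_of_mem hl, ?_, ?_, ?_⟩
  · intro v hv
    rw [Finset.mem_insert] at hv ⊢
    rw [mem_allies]
    rcases hv with rfl | hv
    · rcases hlk with h | h
      · exact Or.inl h.symm
      · exact Or.inr h
    · have h := hC hv
      rw [Finset.mem_insert, mem_allies] at h
      exact h.imp_right fun h => hle (deleteAlliance_le _ _ _ h)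
  · simp [hne, hi]
  · intro C' hiC' hC' hcl
    have hkC' : k ∉ C' := fun h => by
      have := hC' h
      simp [hne.symm] at this
    have hlC' : l ∉ C' := fun h => by
      have := hC' h
      simp only [Finset.mem_insert, Finset.mem_sdiff, hl, or_true, not_true, and_false,
        or_false] at this
      exact hi (this ▸ hl)
    -- Both `k` and `l` are among the attackers, so a defending clique uses neither `ik` nor an
    -- alliance of `g'` outside `g`, all of which involve `l`.
    have hadj : ∀ u ∈ C', ∀ v ∈ C', u ≠ v → (deleteAlliance g i k).Adj u v := by
      intro u hu v hv huv
      rw [deleteAlliance_adj]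
      refine ⟨hg' u v (hcl hu hv huv) (fun h => hlC' (h ▸ hu)) (fun h => hlC' (h ▸ hv)), ?_⟩
      rintro (⟨-, rfl⟩ | ⟨rfl, -⟩)
      · exact hkC' hv
      · exact hkC' hu
    have hw : Wins M γ C C' := by
      refine hwin C' hiC' ?_ (fun u hu v hv huv => hadj u hu v hv huv)
      intro v hv
      rw [Finset.mem_insert, Finset.mem_sdiff, mem_allies]
      by_cases hvi : v = i
      · exact Or.inl hvi
      · refine Or.inr ⟨hadj i hiC' v hv (Ne.symm hvi), ?_⟩
        have h := hC' hv
        simp only [Finset.mem_insert, Finset.mem_sdiff, hvi, false_or, not_or] at h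
        exact h.2.2
    calc γ (insert k C) C' * M C' ≤ γ C C' * M C' :=
          mul_le_mul_of_nonneg_right
            (hT.advantage_antitone _ _ _ _ (Finset.subset_insert _ _) subset_rfl)
            (hT.strength_nonneg _)
      _ < M C := hw
      _ ≤ M (insert k C) := hT.strength_mono _ _ (Finset.subset_insert _ _)

/-- The country `k` dropped by `i` can always be recruited by the leader `l` of the attack, at the
cost of at most one new alliance `lk`, and stability forbids vulnerability after that addition too.
-/
theorem not_ncWarStable_of_ne_bot (hT : IsWarTechnology M γ) {g : SimpleGraph V} (hg : g ≠ ⊥) :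
    ¬ NCWarStable M γ g := by
  intro hst
  obtain ⟨i, k, hik⟩ : ∃ i k, g.Adj i k := by
    by_contra! h
    exact hg (by ext u v; simp [h])
  obtain ⟨l, C, hl, hC, hi, hwin⟩ := (hst.delete_vulnerable i k hik).1
  by_cases hlk : l = k ∨ g.Adj l k
  · exact hst.not_vulnerable i
      (ncVulnerable_of_deleteAlliance hT hik hl hC hi hwin le_rfl (fun _ _ h _ _ => h) hlk)
  · rw [not_or] at hlk
    refine hst.add_not_vulnerable l k hlk.1 hlk.2 i
      (ncVulnerable_of_deleteAlliance hT hik hl hC hi hwin (le_addAlliance _ _ _) ?_ (Or.inr ?_))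
    · intro u v h hu hv
      rw [addAlliance_adj] at h
      tauto
    · rw [addAlliance_adj]
      exact Or.inr ⟨Or.inl ⟨rfl, rfl⟩, hlk.1⟩

/-- A leader with at most one ally commands at most two countries, and `i` can at least defend
alone. The degree bound covers both the empty network and a network with one alliance. -/
theorem not_ncVulnerable_of_pairs (hT : IsWarTechnology M γ) (hV : 3 ≤ Fintype.card V)
    (hM : ∀ i j k : V, i ≠ j → i ≠ k → j ≠ k → M {j, k} ≤ γ {j, k} {i} * M {i})
    {g : SimpleGraph V} (hg : ∀ l, (allies g l).card ≤ 1) (i : V) : ¬ NCVulnerable M γ g i := by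
  rintro ⟨l, C, -, hC, hi, hwin⟩
  have hw : Wins M γ C {i} := hwin {i} (by simp) (by simp) (by simp)
  have hcard : C.card ≤ 2 :=
    (Finset.card_le_card hC).trans ((Finset.card_insert_le _ _).trans (by have := hg l; omega))
  -- A smaller coalition is padded to a pair avoiding `i`, which requires three countries;
  -- monotonicity makes the pair at least as strong.
  obtain ⟨E, hCE, hE, hE2⟩ := Finset.exists_subsuperset_card_eq
    (s := C) (t := Finset.univ.erase i) (n := 2)
    (fun v hv => by simpa using fun h : v = i => hi (h ▸ hv)) hcard
    (by rw [Finset.card_erase_of_mem (Finset.mem_univ _), Finset.card_univ]; omega)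
  obtain ⟨j, k, hjk, rfl⟩ := Finset.card_eq_two.1 hE2
  have hij : j ≠ i := by simpa using hE (Finset.mem_insert_self j {k})
  have hik : k ≠ i := by simpa using hE (show k ∈ ({j, k} : Finset V) by simp)
  have h1 := hM i j k hij.symm hik.symm hjk
  have h2 : γ {j, k} {i} * M {i} ≤ γ C {i} * M {i} :=
    mul_le_mul_of_nonneg_right (hT.advantage_antitone _ _ _ _ hCE subset_rfl)
      (hT.strength_nonneg _)
  have h3 := hT.strength_mono _ _ hCE
  have h4 : γ C {i} * M {i} < M C := hw
  linarith

theorem ncWarStable_bot_iff (hT : IsWarTechnology M γ) (hV : 3 ≤ Fintype.card V) :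
    NCWarStable M γ (⊥ : SimpleGraph V) ↔
      ∀ i j k : V, i ≠ j → i ≠ k → j ≠ k → M {j, k} ≤ γ {j, k} {i} * M {i} := by
  constructor
  · intro hst i j k hij hik hjk
    by_contra! hlt
    refine hst.add_not_vulnerable j k hjk (by simp) i ⟨j, {j, k}, by simp, ?_, by simp [hij, hik], ?_⟩
    · intro v hv
      simp only [Finset.mem_insert, Finset.mem_singleton, mem_allies, addAlliance_adj] at hv ⊢
      rcases hv with rfl | rfl
      · exact Or.inl rfl
      · simp [hjk]
    · intro C' hi hC' _
      have : C' = {i} := by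
        refine Finset.Subset.antisymm (fun v hv => ?_) (by simpa using hi)
        have := hC' hv
        simp only [Finset.mem_insert, Finset.mem_sdiff, mem_allies, addAlliance_adj] at this
        simp only [Finset.mem_singleton]
        simp only [SimpleGraph.bot_adj, hij, hik] at this
        tauto
      rw [this]
      exact hlt
  · intro hM
    refine ⟨not_ncVulnerable_of_pairs hT hV hM fun l => ?_, fun j k hjk _ =>
      not_ncVulnerable_of_pairs hT hV hM fun l => ?_, fun j k h => by simp at h⟩
    · rw [Finset.card_le_one]
      intro a ha
      simp [mem_allies] at ha
    · rw [Finset.card_le_one]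
      intro a ha b hb
      simp only [mem_allies, addAlliance_adj, SimpleGraph.bot_adj, false_or] at ha hb
      grind

end NC

/-! ### CN-vulnerability: Hajnal's inequality, reduction to counting, the empty network -/

section CN

theorem card_sdiff_real {V : Type*} [DecidableEq V] (A C : Finset V) :
    ((A \ C).card : ℝ) = (A.card : ℝ) - ((A ∩ C).card : ℝ) := by
  rw [← Finset.card_sdiff_add_card_inter A C]
  push_cast
  ring

/-- **Hajnal's inequality** for families of cliques of maximum size. -/
theorem two_mul_le_card_inter_add_card_union {V ι : Type*} [DecidableEq V]
    {g : SimpleGraph V} {s : ℕ} (A : ι → Finset V)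
    (N : Finset V) (hN : ∀ C ⊆ N, g.IsClique (C : Set V) → C.card ≤ s) (J : Finset ι)
    (hJ : J.Nonempty)
    (hA : ∀ j ∈ J, A j ⊆ N ∧ g.IsClique (A j : Set V) ∧ (A j).card = s) :
    ∃ I U : Finset V, (∀ v, v ∈ I ↔ ∀ j ∈ J, v ∈ A j) ∧ (∀ v, v ∈ U ↔ ∃ j ∈ J, v ∈ A j) ∧
      2 * s ≤ I.card + U.card := by
  induction hJ using Finset.Nonempty.cons_induction with
  | singleton a =>
    refine ⟨A a, A a, by simp, by simp, ?_⟩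
    have := (hA a (by simp)).2.2
    omega
  | cons a J ha hJ ih =>
    obtain ⟨I, U, hI, hU, hle⟩ := ih fun j hj => hA j (Finset.mem_cons_of_mem hj)
    obtain ⟨haN, hac, has⟩ := hA a (Finset.mem_cons_self _ _)
    have hA' : ∀ j ∈ J, A j ⊆ N ∧ g.IsClique (A j : Set V) ∧ (A j).card = s :=
      fun j hj => hA j (Finset.mem_cons_of_mem hj)
    refine ⟨A a ∩ I, A a ∪ U, ?_, ?_, ?_⟩
    · intro v
      simp [hI]
    · intro v
      simp [hU]
    · have hIU : I ⊆ U := fun v hv => by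
        obtain ⟨j, hj⟩ := hJ
        exact (hU v).2 ⟨j, hj, (hI v).1 hv j hj⟩
      have hUN : U ⊆ N := fun v hv => by
        obtain ⟨j, hj, hv⟩ := (hU v).1 hv
        exact (hA' j hj).1 hv
      have hadj : ∀ u ∈ I, ∀ v ∈ U, u ≠ v → g.Adj u v := fun u hu v hv huv => by
        obtain ⟨j, hj, hv⟩ := (hU v).1 hv
        exact (hA' j hj).2.1 ((hI u).1 hu j hj) hv huv
      -- Each member of `I` is adjacent to all other members of `U`, so this union is a clique in
      -- `N`. Its size bound is exactly what keeps `I.card + U.card` from decreasing when `A a` is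
      -- included.
      have hcl : ((A a ∩ U) ∪ I).card ≤ s := by
        refine hN _ (Finset.union_subset (Finset.inter_subset_left.trans haN) (hIU.trans hUN)) ?_
        intro u hu v hv huv
        simp only [Finset.coe_union, Finset.coe_inter, Set.mem_union, Set.mem_inter_iff,
          Finset.mem_coe] at hu hv
        rcases hu with ⟨hu, hu'⟩ | hu
        · rcases hv with ⟨hv, -⟩ | hv
          · exact hac hu hv huv
          · exact (hadj v hv u hu' huv.symm).symm
        · rcases hv with ⟨-, hv⟩ | hv
          · exact hadj u hu v hv huv
          · exact hadj u hu v (hIU hv) huv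
      have h1 := Finset.card_union_add_card_inter (A a ∩ U) I
      have h2 := Finset.card_union_add_card_inter (A a) U
      have h3 : A a ∩ U ∩ I = A a ∩ I := by
        rw [Finset.inter_assoc, Finset.inter_eq_right.2 hIU]
      rw [h3] at h1
      omega

variable {V : Type*} [Fintype V] [DecidableEq V]

/-- CN-vulnerability for equal strengths and a constant advantage, in terms of cardinalities. -/
def Outnumbered (γ : ℝ) (g : SimpleGraph V) (i : V) : Prop :=
  ∃ C : Finset V, g.IsClique (C : Set V) ∧ i ∉ C ∧
    γ * (((allies g i \ C).card : ℝ) + 1) < (C.card : ℝ)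

theorem cnVulnerable_iff_outnumbered {m γ : ℝ} (hm : 0 < m) (hγ : 0 < γ) (g : SimpleGraph V)
    (i : V) :
    CNVulnerable (additiveStrength fun _ => m) (fun _ _ => γ) g i ↔ Outnumbered γ g i := by
  have key : ∀ C : Finset V, Wins (additiveStrength fun _ => m) (fun _ _ => γ) C
      (insert i (allies g i \ C)) ↔ γ * (((allies g i \ C).card : ℝ) + 1) < (C.card : ℝ) := by
    intro C
    have hi : i ∉ allies g i \ C := by simp [mem_allies]
    rw [Wins, additiveStrength, additiveStrength, Finset.sum_const, Finset.sum_const,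
      Finset.card_insert_of_notMem hi, nsmul_eq_mul, nsmul_eq_mul, ← mul_assoc]
    push_cast
    exact mul_lt_mul_iff_left₀ hm
  constructor
  · rintro ⟨C, -, hC, hi, hw⟩
    exact ⟨C, hC, hi, (key C).1 hw⟩
  · rintro ⟨C, hC, hi, hw⟩
    refine ⟨C, ?_, hC, hi, (key C).2 hw⟩
    rw [← Finset.card_pos]
    have : 0 < γ * (((allies g i \ C).card : ℝ) + 1) := by positivity
    exact_mod_cast this.trans hw

theorem cnWarStable_iff {m γ : ℝ} (hm : 0 < m) (hγ : 0 < γ) (g : SimpleGraph V) :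
    CNWarStable (additiveStrength fun _ => m) (fun _ _ => γ) g ↔ WarStable (Outnumbered γ) g := by
  have : CNVulnerable (V := V) (additiveStrength fun _ => m) (fun _ _ => γ) = Outnumbered γ := by
    ext g i
    exact cnVulnerable_iff_outnumbered hm hγ g i
  rw [CNWarStable, this]

variable {γ : ℝ} {g : SimpleGraph V}

theorem warStable_bot (hγ : 2 ≤ γ) : WarStable (Outnumbered γ) (⊥ : SimpleGraph V) := by
  have key : ∀ (g : SimpleGraph V), (∀ C : Finset V, g.IsClique (C : Set V) → C.card ≤ 2) →
      ∀ i, ¬ Outnumbered γ g i := by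
    rintro g hg i ⟨C, hC, -, hlt⟩
    have h1 : (C.card : ℝ) ≤ 2 := by exact_mod_cast hg C hC
    have h2 : (0 : ℝ) ≤ ((allies g i \ C).card : ℝ) := by positivity
    nlinarith
  refine ⟨key _ fun C hC => ?_, fun j k _ _ => key _ fun C hC => ?_, fun j k h => by simp at h⟩
  · have : C.card ≤ 1 := by
      rw [Finset.card_le_one]
      intro a ha b hb
      by_contra hab
      simpa using hC ha hb hab
    omega
  · by_contra! h
    obtain ⟨a, b, c, ha, hb, hc, hab, hac, hbc⟩ := Finset.two_lt_card_iff.1 h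
    have h1 := hC ha hb hab
    have h2 := hC ha hc hac
    have h3 := hC hb hc hbc
    simp only [addAlliance_adj, SimpleGraph.bot_adj, false_or] at h1 h2 h3
    grind

theorem not_warStable_bot (hV : 3 ≤ Fintype.card V) (hγ : γ < 2) :
    ¬ WarStable (Outnumbered γ) (⊥ : SimpleGraph V) := by
  intro hst
  obtain ⟨i, j, k, hij, hik, hjk⟩ := Fintype.two_lt_card_iff.1 hV
  refine hst.add_not_vulnerable j k hjk (by simp) i ⟨{j, k}, ?_, by simp [hij, hik], ?_⟩
  · intro u hu v hv huv
    simp only [Finset.coe_insert, Finset.coe_singleton, Set.mem_insert_iff,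
      Set.mem_singleton_iff] at hu hv
    rw [addAlliance_adj]
    grind
  · have : allies (addAlliance ⊥ j k) i = ∅ := by
      ext v
      simp [mem_allies, addAlliance_adj, hij, hik]
    rw [this, Finset.card_pair hjk]
    simpa using hγ

/-! ### No nonempty CN-war-stable network when `1 ≤ γ` -/

section LargeAdvantage

/-- The attack of `K.erase x` on `x` fails, and all the attackers are allies of `x`. The clique `K`
need not be maximum. -/
theorem card_allies_bound_of_maximum_clique (hst : WarStable (Outnumbered γ) g) {K : Finset V}
    (hK : g.IsClique (K : Set V)) {x : V} (hx : x ∈ K) :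
    (K.card : ℝ) - 1 ≤ γ * ((allies g x).card + 2 - K.card) := by
  by_contra! hlt
  refine hst.not_vulnerable x ⟨K.erase x, hK.subset (by simp), by simp, ?_⟩
  have hsub : K.erase x ⊆ allies g x := fun v hv => by
    rw [Finset.mem_erase] at hv
    exact mem_allies.2 (hK hx hv.2 hv.1.symm)
  rw [card_sdiff_real, Finset.inter_eq_right.2 hsub, Finset.cast_card_erase_of_mem hx]
  linarith

/-- The clique that wins after the deletion of `xj` omits `j`: with `j` among the attackers the
deletion would not change the defence, and `x` would be vulnerable at `g`. The lost defender `j`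
cancels the `+ 1` that counts `x`. -/
theorem exists_clique_of_adj (hst : WarStable (Outnumbered γ) g) {x j : V} (hxj : g.Adj x j) :
    ∃ C : Finset V, g.IsClique (C : Set V) ∧ x ∉ C ∧ j ∉ C ∧
      γ * ((allies g x).card - (allies g x ∩ C).card) < (C.card : ℝ) := by
  obtain ⟨C, hC, hx, hlt⟩ := (hst.delete_vulnerable x j hxj).1
  have hC' : g.IsClique (C : Set V) := hC.mono (deleteAlliance_le _ _ _)
  have hal : allies (deleteAlliance g x j) x = (allies g x).erase j := by
    ext v
    rw [mem_allies, deleteAlliance_adj, Finset.mem_erase, mem_allies]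
    have := hxj.ne
    grind
  rw [hal] at hlt
  have hj : j ∉ C := fun hj => hst.not_vulnerable x ⟨C, hC', hx, by
    rwa [Finset.erase_sdiff_comm, Finset.erase_eq_of_notMem (by simp [hj])] at hlt⟩
  refine ⟨C, hC', hx, hj, ?_⟩
  have hjm : j ∈ allies g x \ C := Finset.mem_sdiff.2 ⟨mem_allies.2 hxj, hj⟩
  rw [Finset.erase_sdiff_comm, Finset.cast_card_erase_of_mem hjm, sub_add_cancel,
    card_sdiff_real] at hlt
  exact hlt

theorem card_inter_allies_lt {C : Finset V} (hC : g.IsClique (C : Set V)) (x : V) :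
    (allies g x ∩ C).card + 1 ≤ g.cliqueNum := by
  have hx : x ∉ allies g x ∩ C := by simp [mem_allies]
  rw [← Finset.card_insert_of_notMem hx]
  refine SimpleGraph.IsClique.card_le_cliqueNum (tc := ?_)
  rw [Finset.coe_insert, SimpleGraph.isClique_insert]
  refine ⟨hC.subset (by simp), fun b hb _ => ?_⟩
  simp only [Finset.coe_inter, Set.mem_inter_iff, Finset.mem_coe, mem_allies] at hb
  exact hb.1

/-- Combines `|N(y) ∩ C| ≤ ω - 1` with `|C| ≤ ω`. It holds for every `y` with an ally and says that
`ω` attackers, all allies of `y`, would win against `y`. -/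
theorem lt_of_mem_maximum_clique (hγ : 1 ≤ γ) (hst : WarStable (Outnumbered γ) g) {y j : V}
    (hy : g.Adj y j) :
    γ * ((allies g y).card + 1 - g.cliqueNum) < (g.cliqueNum : ℝ) := by
  obtain ⟨C, hC, -, -, hlt⟩ := exists_clique_of_adj hst hy
  have h1 : ((allies g y ∩ C).card : ℝ) + 1 ≤ g.cliqueNum := by
    exact_mod_cast card_inter_allies_lt hC y
  have h2 : (C.card : ℝ) ≤ g.cliqueNum := by
    exact_mod_cast SimpleGraph.IsClique.card_le_cliqueNum (tc := hC)
  nlinarith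

/-- If `x` misses only `z` in a maximum clique, then adding `xz` creates a clique of size `ω + 1`. A
member `y` other than `x` and `z` gains no ally, yet faces `ω` attackers, all of them its allies. -/
theorem not_almost_clique (hγ : 1 ≤ γ) (hst : WarStable (Outnumbered γ) g) {C : Finset V} {x : V}
    (hC : g.IsClique (C : Set V)) (hx : x ∉ C) (hc : C.card = g.cliqueNum) (h2 : 2 ≤ C.card)
    (ha : (allies g x ∩ C).card + 1 = C.card) : False := by
  have hz : (C \ allies g x).card = 1 := by
    have := Finset.card_sdiff_add_card_inter C (allies g x)
    rw [Finset.inter_comm] at this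
    omega
  obtain ⟨z, hz⟩ := Finset.card_eq_one.1 hz
  have hz' : ∀ v, v ∈ C ∧ ¬ g.Adj x v ↔ v = z := fun v => by
    rw [← Finset.mem_singleton, ← hz, Finset.mem_sdiff, mem_allies]
  obtain ⟨hzC, hxz⟩ := (hz' z).2 rfl
  have hne : x ≠ z := fun h => hx (h ▸ hzC)
  obtain ⟨y, hy⟩ : (allies g x ∩ C).Nonempty := Finset.card_pos.1 (by omega)
  rw [Finset.mem_inter, mem_allies] at hy
  have hyz : y ≠ z := fun h => hxz (h ▸ hy.1)
  have hyx : y ≠ x := hy.1.ne'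
  have hbound := lt_of_mem_maximum_clique hγ hst hy.1.symm
  refine hst.add_not_vulnerable x z hne hxz y ⟨insert x (C.erase y), ?_, by simp [hyx], ?_⟩
  · rw [Finset.coe_insert, SimpleGraph.isClique_insert]
    refine ⟨(hC.mono (le_addAlliance g x z)).subset (by simp), fun b hb hxb => ?_⟩
    rw [addAlliance_adj]
    have hbC : b ∈ C := Finset.mem_of_mem_erase hb
    by_cases hxb' : g.Adj x b
    · exact Or.inl hxb'
    · exact Or.inr ⟨Or.inl ⟨rfl, (hz' b).1 ⟨hbC, hxb'⟩⟩, hxb⟩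
  · have hal : allies (addAlliance g x z) y = allies g y := by
      ext v
      rw [mem_allies, mem_allies, addAlliance_adj]
      tauto
    have hsub : insert x (C.erase y) ⊆ allies g y := by
      intro v hv
      rw [mem_allies]
      rw [Finset.mem_insert, Finset.mem_erase] at hv
      rcases hv with rfl | hv
      · exact hy.1.symm
      · exact hC hy.2 hv.2 hv.1.symm
    have hcard : ((insert x (C.erase y)).card : ℝ) = g.cliqueNum := by
      rw [Finset.card_insert_of_notMem (by simp [hx]), Finset.card_erase_add_one hy.2, hc]
    rw [hal, card_sdiff_real, Finset.inter_eq_right.2 hsub, hcard]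
    linarith [hbound]

theorem clique_dichotomy (hγ : 1 ≤ γ) (hst : WarStable (Outnumbered γ) g) {K C : Finset V}
    {x : V} (hK : g.IsClique (K : Set V)) (hKc : K.card = g.cliqueNum) (h2 : 2 ≤ K.card)
    (hxK : x ∈ K) (hC : g.IsClique (C : Set V)) (hx : x ∉ C)
    (hlt : γ * ((allies g x).card - (allies g x ∩ C).card) < (C.card : ℝ)) :
    ((allies g x ∩ C).card + 1 = K.card ∧ C.card + 1 = K.card) ∨
      ((allies g x ∩ C).card + 2 = K.card ∧ C.card = K.card) := by
  have h1 := card_allies_bound_of_maximum_clique hst hK hxK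
  have h3 := card_inter_allies_lt hC x
  have h4 := SimpleGraph.IsClique.card_le_cliqueNum (tc := hC)
  have h5 := Finset.card_le_card (Finset.inter_subset_right : allies g x ∩ C ⊆ C)
  rw [← hKc] at h3 h4
  have h4' : (C.card : ℝ) ≤ K.card := by exact_mod_cast h4
  -- Otherwise at least one more defender than in the failed attack of `K.erase x` remains; since `1
  -- ≤ γ`, beating the defence would take more than `K.card` attackers.
  have h6 : K.card ≤ (allies g x ∩ C).card + 2 := by
    by_contra! h
    have h' : ((allies g x ∩ C).card : ℝ) + 3 ≤ K.card := by exact_mod_cast h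
    nlinarith
  rcases (show (allies g x ∩ C).card + 1 = K.card ∨ (allies g x ∩ C).card + 2 = K.card by omega)
    with h | h
  · refine Or.inl ⟨h, ?_⟩
    have : C.card ≠ K.card := fun hc =>
      not_almost_clique hγ hst hC hx (hc.trans hKc) (hc ▸ h2) (hc ▸ h)
    omega
  · refine Or.inr ⟨h, ?_⟩
    have h' : ((allies g x ∩ C).card : ℝ) = K.card - 2 := by
      rw [← h]; push_cast; ring
    rw [h'] at hlt
    have : (K.card : ℝ) < C.card + 1 := by linarith
    have : K.card < C.card + 1 := by exact_mod_cast this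
    omega

/-- In the first case of the dichotomy this is the winning inequality itself; in the second it
follows after subtracting `γ ≥ 1`. -/
theorem card_allies_lt_of_maximum_clique (hγ : 1 ≤ γ) (hst : WarStable (Outnumbered γ) g)
    {K : Finset V} {x : V} (hK : g.IsClique (K : Set V)) (hKc : K.card = g.cliqueNum)
    (h2 : 2 ≤ K.card) (hxK : x ∈ K) :
    γ * ((allies g x).card + 1 - K.card) < (K.card : ℝ) - 1 := by
  obtain ⟨j, hj, hjx⟩ := Finset.exists_mem_ne h2 x
  obtain ⟨C, hC, hx, -, hlt⟩ := exists_clique_of_adj hst (hK hxK hj hjx.symm)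
  rcases clique_dichotomy hγ hst hK hKc h2 hxK hC hx hlt with ⟨h, h'⟩ | ⟨h, h'⟩
  · have e1 : ((allies g x ∩ C).card : ℝ) = K.card - 1 := by rw [← h]; push_cast; ring
    have e2 : (C.card : ℝ) = K.card - 1 := by rw [← h']; push_cast; ring
    rw [e1, e2] at hlt
    linarith
  · have e1 : ((allies g x ∩ C).card : ℝ) = K.card - 2 := by rw [← h]; push_cast; ring
    rw [e1, h'] at hlt
    linarith

/-- Let `x` miss `z` and `w` in the maximum clique `C`. After adding `xz`, replacing `w` by `x` in
`C` gives a clique of size `ω` that attacks `w`. It leaves `w` no better defended than `x` was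
against `C`, because `w` has at most as many allies as `x`. -/
theorem not_two_missing (hγ : 1 ≤ γ) (hst : WarStable (Outnumbered γ) g)
    {K C : Finset V} {x : V} (hK : g.IsClique (K : Set V)) (hKc : K.card = g.cliqueNum)
    (h2 : 2 ≤ K.card) (hxK : x ∈ K) (hC : g.IsClique (C : Set V)) (hx : x ∉ C)
    (hlt : γ * ((allies g x).card - (allies g x ∩ C).card) < (C.card : ℝ))
    (ha : (allies g x ∩ C).card + 2 = K.card) (hc : C.card = K.card) : False := by
  have hzw : (C \ allies g x).card = 2 := by
    have := Finset.card_sdiff_add_card_inter C (allies g x)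
    rw [Finset.inter_comm] at this
    omega
  obtain ⟨z, w, hne, hzw⟩ := Finset.card_eq_two.1 hzw
  have hmem : ∀ v, v ∈ C ∧ ¬ g.Adj x v ↔ v = z ∨ v = w := fun v => by
    simpa [mem_allies] using Finset.ext_iff.1 hzw v
  obtain ⟨hzC, hxz⟩ := (hmem z).2 (Or.inl rfl)
  obtain ⟨hwC, hxw⟩ := (hmem w).2 (Or.inr rfl)
  have hxz' : x ≠ z := fun h => hx (h ▸ hzC)
  have hxw' : w ≠ x := fun h => hx (h ▸ hwC)
  -- The upper bound for `w ∈ C` and the lower bound for `x ∈ K` differ by one ally, and integrality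
  -- closes the gap.
  have hdeg : ((allies g w).card : ℝ) ≤ (allies g x).card := by
    have hw := card_allies_lt_of_maximum_clique hγ hst hC (hc.trans hKc) (hc ▸ h2) hwC
    have hx := card_allies_bound_of_maximum_clique hst hK hxK
    rw [hc] at hw
    have : γ * ((allies g w).card + 1 - K.card) < γ * ((allies g x).card + 2 - K.card) :=
      hw.trans_le hx
    have := lt_of_mul_lt_mul_left this (by linarith)
    have : ((allies g w).card : ℝ) < (allies g x).card + 1 := by linarith
    have : (allies g w).card < (allies g x).card + 1 := by exact_mod_cast this
    exact_mod_cast Nat.lt_succ_iff.1 this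
  refine hst.add_not_vulnerable x z hxz' hxz w ⟨insert x (C.erase w), ?_, by simp [hxw'], ?_⟩
  · rw [Finset.coe_insert, SimpleGraph.isClique_insert]
    refine ⟨(hC.mono (le_addAlliance g x z)).subset (by simp), fun b hb hxb => ?_⟩
    rw [addAlliance_adj]
    have hb' := Finset.mem_erase.1 (Finset.mem_coe.1 hb)
    by_cases hxb' : g.Adj x b
    · exact Or.inl hxb'
    · exact Or.inr ⟨Or.inl ⟨rfl, ((hmem b).1 ⟨hb'.2, hxb'⟩).resolve_right hb'.1⟩, hxb⟩
  · have hal : allies (addAlliance g x z) w = allies g w := by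
      ext v
      rw [mem_allies, mem_allies, addAlliance_adj]
      have := hne.symm
      tauto
    have hsub : C.erase w ⊆ allies g w := by
      intro v hv
      rw [Finset.mem_erase] at hv
      exact mem_allies.2 (hC hwC hv.2 hv.1.symm)
    have hxa : x ∉ allies g w := by
      rw [mem_allies]
      exact fun h => hxw h.symm
    have hcard : ((insert x (C.erase w)).card : ℝ) = C.card := by
      rw [Finset.card_insert_of_notMem (by simp [hx]), Finset.card_erase_add_one hwC]
    have ha' : ((allies g x ∩ C).card : ℝ) = C.card - 2 := by
      rw [hc, ← ha]; push_cast; ring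
    rw [hal, card_sdiff_real, Finset.inter_insert_of_notMem hxa, Finset.inter_eq_right.2 hsub,
      hcard, Finset.cast_card_erase_of_mem hwC]
    rw [ha'] at hlt
    nlinarith

theorem eq_bot_of_warStable (hγ : 1 ≤ γ) (hst : WarStable (Outnumbered γ) g) : g = ⊥ := by
  by_contra hg
  obtain ⟨u, v, huv⟩ : ∃ u v, g.Adj u v := by
    by_contra! h
    exact hg (by ext u v; simp [h])
  obtain ⟨K, hK⟩ := g.exists_isNClique_cliqueNum
  have hKc := hK.card_eq
  have hKcl := hK.isClique
  have h2 : 2 ≤ K.card := by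
    rw [hKc, ← Finset.card_pair huv.ne]
    refine SimpleGraph.IsClique.card_le_cliqueNum (tc := ?_)
    simpa [SimpleGraph.isClique_pair] using fun _ => huv
  obtain ⟨x, hxK⟩ : K.Nonempty := Finset.card_pos.1 (by omega)
  have hA : ∀ j : V, ∃ A : Finset V, g.Adj x j →
      (A ⊆ allies g x ∧ g.IsClique (A : Set V) ∧ A.card = K.card - 1) ∧ j ∉ A := by
    intro j
    by_cases hj : g.Adj x j
    · obtain ⟨C, hC, hx, hjC, hlt⟩ := exists_clique_of_adj hst hj
      rcases clique_dichotomy hγ hst hKcl hKc h2 hxK hC hx hlt with ⟨h, h'⟩ | ⟨h, h'⟩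
      · exact ⟨allies g x ∩ C, fun _ => ⟨⟨Finset.inter_subset_left, hC.subset (by simp),
          by omega⟩, by simp [hjC]⟩⟩
      · exact (not_two_missing hγ hst hKcl hKc h2 hxK hC hx hlt h h').elim
    · exact ⟨∅, fun h => absurd h hj⟩
  choose A hA using hA
  obtain ⟨j, hj, hjx⟩ := Finset.exists_mem_ne h2 x
  obtain ⟨I, U, hI, hU, hle⟩ := two_mul_le_card_inter_add_card_union (g := g) (s := K.card - 1)
    A (allies g x) (fun C hCx hC => by
      have := card_inter_allies_lt hC x
      rw [Finset.inter_eq_right.2 hCx] at this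
      omega) (allies g x) ⟨j, mem_allies.2 (hKcl hxK hj hjx.symm)⟩
    (fun j hj => (hA j (mem_allies.1 hj)).1)
  -- A common member `v` would be an ally of `x`, but the clique `A v` omits `v`.
  have hI0 : I = ∅ := by
    rw [Finset.eq_empty_iff_forall_notMem]
    intro v hv
    have hvI := (hI v).1 hv
    have hxv : g.Adj x v := by
      have hjx' := mem_allies.2 (hKcl hxK hj hjx.symm)
      exact mem_allies.1 ((hA j (mem_allies.1 hjx')).1.1 (hvI j hjx'))
    exact (hA v hxv).2 (hvI v (mem_allies.2 hxv))
  have hUN : U.card ≤ (allies g x).card := Finset.card_le_card fun v hv => by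
    obtain ⟨j, hj, hv⟩ := (hU v).1 hv
    exact (hA j (mem_allies.1 hj)).1.1 hv
  have hd := card_allies_lt_of_maximum_clique hγ hst hKcl hKc h2 hxK
  rw [hI0, Finset.card_empty] at hle
  have hd2 : 2 * K.card ≤ (allies g x).card + 2 := by omega
  have hd2' : 2 * (K.card : ℝ) ≤ (allies g x).card + 2 := by exact_mod_cast hd2
  have hK2 : (2 : ℝ) ≤ K.card := by exact_mod_cast h2
  nlinarith

end LargeAdvantage

end CN

/-! ### A stability criterion for networks covered by lines -/

section Lines

variable {V : Type*} [Fintype V] [DecidableEq V] {γ : ℝ} {g : SimpleGraph V}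

theorem card_sdiff_mono {g' : SimpleGraph V} (h : g ≤ g') (i : V) (C : Finset V) :
    ((allies g i).card : ℝ) - ((allies g i ∩ C).card : ℝ) ≤ ((allies g' i \ C).card : ℝ) := by
  rw [← card_sdiff_real]
  refine Nat.cast_le.2 (Finset.card_le_card (Finset.sdiff_subset_sdiff (fun v hv => ?_) subset_rfl))
  exact mem_allies.2 (h (mem_allies.1 hv))

/-- A criterion for war-stability of a network whose large cliques lie on lines of a common
size `s`, any two of which meet in at most one point. -/
theorem warStable_of_lines (hγ : 0 < γ) {s : ℕ} (lines : Set (Finset V))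
    (hclique : ∀ L ∈ lines, g.IsClique (L : Set V))
    (hcard : ∀ L ∈ lines, L.card = s)
    (hinter : ∀ L₁ ∈ lines, ∀ L₂ ∈ lines, ∀ u v : V, u ≠ v → u ∈ L₁ → v ∈ L₁ → u ∈ L₂ →
      v ∈ L₂ → L₁ = L₂)
    (hbig : ∀ C : Finset V, g.IsClique (C : Set V) → 4 ≤ C.card → ∃ L ∈ lines, C ⊆ L)
    (hsmall : ∀ v, 4 + γ * 4 ≤ γ * ((allies g v).card + 1))
    (hout : ∀ v, ∀ L ∈ lines, v ∉ L → (allies g v ∩ L).card ≤ 1 ∧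
      s ≤ γ * (allies g v).card)
    (hin : ∀ v, ∀ L ∈ lines, v ∈ L → (s : ℝ) - 1 ≤ γ * ((allies g v).card - (s - 1) + 1))
    (hdel : ∀ v j, g.Adj v j →
      (∃ L ∈ lines, v ∈ L ∧ j ∉ L ∧ γ * ((allies g v).card - (s - 1)) < (s : ℝ) - 1) ∨
      (∃ L ∈ lines, v ∉ L ∧ j ∉ L ∧ (allies g v ∩ L).Nonempty ∧
        γ * ((allies g v).card - 1) < (s : ℝ))) :
    WarStable (Outnumbered γ) g := by
  -- New alliances only strengthen the defence, so allies are counted in `g` and one argument covers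
  -- `g` and every `g + jk`. Attackers numbering at most four lose by `hsmall`; larger cliques lie
  -- on a line.
  have key : ∀ g' : SimpleGraph V, g ≤ g' →
      (∀ C : Finset V, g'.IsClique (C : Set V) → 5 ≤ C.card → ∃ L ∈ lines, C ⊆ L) →
      ∀ i, ¬ Outnumbered γ g' i := by
    rintro g' hg' hbig' i ⟨C, hC, hi, hlt⟩
    have hle := card_sdiff_mono hg' i C
    have hlt' : γ * ((allies g i).card - (allies g i ∩ C).card + 1) < (C.card : ℝ) :=
      (mul_le_mul_of_nonneg_left (by linarith) hγ.le).trans_lt hlt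
    have hCi : ((allies g i ∩ C).card : ℝ) ≤ C.card :=
      Nat.cast_le.2 (Finset.card_le_card Finset.inter_subset_right)
    by_cases h5 : 5 ≤ C.card
    · obtain ⟨L, hL, hCL⟩ := hbig' C hC h5
      by_cases hiL : i ∈ L
      · have h1 := hin i L hL hiL
        have h2 : C.card + 1 ≤ s := by
          rw [← hcard L hL, ← Finset.card_insert_of_notMem hi]
          exact Finset.card_le_card (Finset.insert_subset hiL hCL)
        have h2' : (C.card : ℝ) + 1 ≤ s := by exact_mod_cast h2
        nlinarith
      · obtain ⟨h1, h2⟩ := hout i L hL hiL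
        have h3 : (C.card : ℝ) ≤ s := by
          rw [← hcard L hL]
          exact Nat.cast_le.2 (Finset.card_le_card hCL)
        have h4 : ((allies g i ∩ C).card : ℝ) ≤ 1 := by
          exact_mod_cast (Finset.card_le_card (Finset.inter_subset_inter_left hCL)).trans h1
        nlinarith
    · have h4 : (C.card : ℝ) ≤ 4 := by exact_mod_cast Nat.lt_succ_iff.1 (not_le.1 h5)
      have := hsmall i
      nlinarith
  refine ⟨key g le_rfl fun C hC h5 => hbig C hC (by omega), fun j k hjk hnadj =>
    key _ (le_addAlliance g j k) fun C hC h5 => ?_, ?_⟩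
  -- Removing `j` or `k` from a clique of `g + jk` leaves a clique of `g`, with at least four
  -- members. The two lines obtained share two points of `C \ {j, k}`, so they coincide and contain
  -- `C`.
  · have hcl : ∀ v, (v = j ∨ v = k) → g.IsClique ((C.erase v : Finset V) : Set V) := by
      intro v hv a ha b hb hab
      have ha' := Finset.mem_erase.1 (Finset.mem_coe.1 ha)
      have hb' := Finset.mem_erase.1 (Finset.mem_coe.1 hb)
      have h := hC ha'.2 hb'.2 hab
      rw [addAlliance_adj] at h
      grind
    have hpred := fun v => Finset.pred_card_le_card_erase (s := C) (a := v)
    obtain ⟨L₁, hL₁, hCL₁⟩ := hbig _ (hcl j (Or.inl rfl)) (by have := hpred j; omega)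
    obtain ⟨L₂, hL₂, hCL₂⟩ := hbig _ (hcl k (Or.inr rfl)) (by have := hpred k; omega)
    have h2 : 1 < ((C.erase j).erase k).card := by
      have := hpred j
      have := Finset.pred_card_le_card_erase (s := C.erase j) (a := k)
      omega
    obtain ⟨u, hu, v, hv, huv⟩ := Finset.one_lt_card.1 h2
    rw [Finset.mem_erase, Finset.mem_erase] at hu hv
    have hL : L₁ = L₂ := hinter L₁ hL₁ L₂ hL₂ u v huv
      (hCL₁ (Finset.mem_erase.2 hu.2)) (hCL₁ (Finset.mem_erase.2 hv.2))
      (hCL₂ (Finset.mem_erase.2 ⟨hu.1, hu.2.2⟩)) (hCL₂ (Finset.mem_erase.2 ⟨hv.1, hv.2.2⟩))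
    refine ⟨L₁, hL₁, fun w hw => ?_⟩
    by_cases hwj : w = j
    · rw [hL]
      exact hCL₂ (Finset.mem_erase.2 ⟨hwj ▸ hjk, hw⟩)
    · exact hCL₁ (Finset.mem_erase.2 ⟨hwj, hw⟩)
  · have hhalf : ∀ v j, g.Adj v j → Outnumbered γ (deleteAlliance g v j) v := by
      intro v j hvj
      have hal : allies (deleteAlliance g v j) v = (allies g v).erase j := by
        ext w
        rw [mem_allies, deleteAlliance_adj, Finset.mem_erase, mem_allies]
        have := hvj.ne
        grind
      have hsd : ∀ C : Finset V, j ∉ C → (((allies (deleteAlliance g v j) v \ C).card : ℝ) + 1) =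
          (allies g v).card - (allies g v ∩ C).card := fun C hj => by
        have hjm : j ∈ allies g v \ C := Finset.mem_sdiff.2 ⟨mem_allies.2 hvj, hj⟩
        rw [hal, Finset.erase_sdiff_comm, Finset.cast_card_erase_of_mem hjm, sub_add_cancel,
          card_sdiff_real]
      have hcl : ∀ C : Finset V, g.IsClique (C : Set V) → j ∉ C →
          (deleteAlliance g v j).IsClique (C : Set V) := by
        intro C hC hj a ha b hb hab
        rw [deleteAlliance_adj]
        refine ⟨hC ha hb hab, ?_⟩
        rintro (⟨-, rfl⟩ | ⟨rfl, -⟩)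
        · exact hj hb
        · exact hj ha
      rcases hdel v j hvj with ⟨L, hL, hv, hj, hlt⟩ | ⟨L, hL, hv, hj, hne, hlt⟩
      · have hj' : j ∉ L.erase v := fun h => hj (Finset.mem_of_mem_erase h)
        refine ⟨L.erase v, hcl _ ((hclique L hL).subset (by simp)) hj', by simp, ?_⟩
        have hsub : L.erase v ⊆ allies g v := fun w hw => by
          rw [Finset.mem_erase] at hw
          exact mem_allies.2 (hclique L hL hv hw.2 hw.1.symm)
        rw [hsd _ hj', Finset.inter_eq_right.2 hsub, Finset.cast_card_erase_of_mem hv, hcard L hL]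
        exact hlt
      · refine ⟨L, hcl _ (hclique L hL) hj, hv, ?_⟩
        rw [hsd _ hj, hcard L hL]
        have : (1 : ℝ) ≤ (allies g v ∩ L).card := by exact_mod_cast Finset.card_pos.2 hne
        nlinarith
    intro j k hjk
    refine ⟨hhalf j k hjk, ?_⟩
    have : deleteAlliance g j k = deleteAlliance g k j := by
      rw [deleteAlliance, deleteAlliance, Sym2.eq_swap]
    rw [this]
    exact hhalf k j hjk.symm

end Lines

/-! ### The grid network -/

section Construction

variable {q s t : ℕ}

/-- The vertices of `gridNetwork`: `q` blocks, each a product of an `s × s` grid and the complete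
bipartite graph on `t + t` vertices, and a special vertex for each block in `R`. -/
abbrev GridVertex (q s t : ℕ) (R : Finset (Fin q)) : Type :=
  (Fin q × Fin s × Fin s × Fin t × Bool) ⊕ R

/-- The diagonal grid points at which the special vertex of a block in `R` is attached. -/
def Marked (R : Finset (Fin q)) (P : Finset (Fin s × Fin t)) (i : Fin q) (a b : Fin s)
    (h : Fin t) : Prop :=
  i ∈ R ∧ a = b ∧ (a, h) ∈ P

/-- Adjacency in `gridNetwork`. -/
def gridAdj (R : Finset (Fin q)) (P : Finset (Fin s × Fin t)) :
    GridVertex q s t R → GridVertex q s t R → Prop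
  | .inl (i, a, b, h, e), .inl (i', a', b', h', e') =>
    i = i' ∧ ((h = h' ∧ e = e' ∧ ((a = a' ∧ b ≠ b') ∨ (a ≠ a' ∧ b = b'))) ∨
      (a = a' ∧ b = b' ∧ e ≠ e' ∧ ¬ (h = h' ∧ Marked R P i a b h)))
  | .inl (i, a, b, h, _), .inr x => i = x ∧ Marked R P i a b h
  | .inr x, .inl (i, a, b, h, _) => i = x ∧ Marked R P i a b h
  | .inr _, .inr _ => False

/-- Disjoint blocks, each the Cartesian product of two complete graphs on `s` vertices and of
`K_{t,t}`; in the blocks that belong to `R`, a special vertex subdivides a matching of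
edges over the diagonal of the grid, selected by `P`. -/
def gridNetwork (R : Finset (Fin q)) (P : Finset (Fin s × Fin t)) :
    SimpleGraph (GridVertex q s t R) where
  Adj := gridAdj R P
  symm := ⟨by
    rintro (⟨i, a, b, h, e⟩ | x) (⟨i', a', b', h', e'⟩ | x') hadj
    · obtain ⟨rfl, ⟨rfl, rfl, hab⟩ | ⟨rfl, rfl, he, hm⟩⟩ := hadj
      · exact ⟨rfl, Or.inl ⟨rfl, rfl, hab.imp (fun h => ⟨h.1.symm, h.2.symm⟩)
          fun h => ⟨h.1.symm, h.2.symm⟩⟩⟩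
      · refine ⟨rfl, Or.inr ⟨rfl, rfl, he.symm, ?_⟩⟩
        rintro ⟨rfl, hm'⟩
        exact hm ⟨rfl, hm'⟩
    · exact hadj
    · exact hadj
    · exact hadj⟩
  loopless := ⟨by
    rintro (⟨i, a, b, h, e⟩ | x) hadj
    · simp [gridAdj] at hadj
    · exact hadj⟩

variable {R : Finset (Fin q)} {P : Finset (Fin s × Fin t)}

theorem gridNetwork_adj_inl_inl {i i' : Fin q} {a a' b b' : Fin s} {h h' : Fin t} {e e' : Bool} :
    (gridNetwork R P).Adj (.inl (i, a, b, h, e)) (.inl (i', a', b', h', e')) ↔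
      i = i' ∧ ((h = h' ∧ e = e' ∧ ((a = a' ∧ b ≠ b') ∨ (a ≠ a' ∧ b = b'))) ∨
        (a = a' ∧ b = b' ∧ e ≠ e' ∧ ¬ (h = h' ∧ Marked R P i a b h))) :=
  Iff.rfl

theorem gridNetwork_adj_inl_inr {i : Fin q} {a b : Fin s} {h : Fin t} {e : Bool} {x : R} :
    (gridNetwork R P).Adj (.inl (i, a, b, h, e)) (.inr x) ↔ i = x ∧ Marked R P i a b h :=
  Iff.rfl

theorem gridNetwork_adj_inr_inl {i : Fin q} {a b : Fin s} {h : Fin t} {e : Bool} {x : R} :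
    (gridNetwork R P).Adj (.inr x) (.inl (i, a, b, h, e)) ↔ i = x ∧ Marked R P i a b h :=
  Iff.rfl

theorem gridNetwork_adj_inr_inr {x y : R} : ¬ (gridNetwork R P).Adj (.inr x) (.inr y) :=
  fun h => h

/-- A row of a grid. -/
def gridRow (R : Finset (Fin q)) (i : Fin q) (a : Fin s) (h : Fin t) (e : Bool) :
    Finset (GridVertex q s t R) :=
  Finset.univ.image fun b => .inl (i, a, b, h, e)

/-- A column of a grid. -/
def gridCol (R : Finset (Fin q)) (i : Fin q) (b : Fin s) (h : Fin t) (e : Bool) :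
    Finset (GridVertex q s t R) :=
  Finset.univ.image fun a => .inl (i, a, b, h, e)

/-- The rows and columns of the grids. -/
def gridLines (s t : ℕ) (R : Finset (Fin q)) : Set (Finset (GridVertex q s t R)) :=
  {L | ∃ i a h e, L = gridRow R i a h e ∨ L = gridCol R i a h e}

theorem inl_mem_gridRow {i i' : Fin q} {a a' b' : Fin s} {h h' : Fin t} {e e' : Bool} :
    .inl (i', a', b', h', e') ∈ gridRow R i a h e ↔ i' = i ∧ a' = a ∧ h' = h ∧ e' = e := by
  simp only [gridRow, Finset.mem_image, Finset.mem_univ, true_and, Sum.inl.injEq, Prod.mk.injEq]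
  grind

theorem inl_mem_gridCol {i i' : Fin q} {b a' b' : Fin s} {h h' : Fin t} {e e' : Bool} :
    .inl (i', a', b', h', e') ∈ gridCol R i b h e ↔ i' = i ∧ b' = b ∧ h' = h ∧ e' = e := by
  simp only [gridCol, Finset.mem_image, Finset.mem_univ, true_and, Sum.inl.injEq, Prod.mk.injEq]
  grind

theorem inr_notMem_gridRow {i : Fin q} {a : Fin s} {h : Fin t} {e : Bool} {x : R} :
    .inr x ∉ gridRow R i a h e := by
  simp [gridRow]

theorem inr_notMem_gridCol {i : Fin q} {a : Fin s} {h : Fin t} {e : Bool} {x : R} :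
    .inr x ∉ gridCol R i a h e := by
  simp [gridCol]

theorem inr_notMem_of_mem_gridLines {L : Finset (GridVertex q s t R)} (hL : L ∈ gridLines s t R)
    (x : R) : .inr x ∉ L := by
  obtain ⟨i, a, h, e, rfl | rfl⟩ := hL
  · exact inr_notMem_gridRow
  · exact inr_notMem_gridCol

theorem isClique_of_mem_gridLines {L : Finset (GridVertex q s t R)} (hL : L ∈ gridLines s t R) :
    (gridNetwork R P).IsClique (L : Set (GridVertex q s t R)) := by
  intro u hu v hv huv
  rcases u with ⟨i, a, b, h, e⟩ | x
  · rcases v with ⟨i', a', b', h', e'⟩ | y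
    · rw [gridNetwork_adj_inl_inl]
      obtain ⟨i₀, a₀, h₀, e₀, rfl | rfl⟩ := hL
      · rw [Finset.mem_coe, inl_mem_gridRow] at hu hv
        grind
      · rw [Finset.mem_coe, inl_mem_gridCol] at hu hv
        grind
    · exact absurd hv (inr_notMem_of_mem_gridLines hL y)
  · exact absurd hu (inr_notMem_of_mem_gridLines hL x)

theorem card_of_mem_gridLines {L : Finset (GridVertex q s t R)} (hL : L ∈ gridLines s t R) :
    L.card = s := by
  obtain ⟨i, a, h, e, rfl | rfl⟩ := hL
  · rw [gridRow, Finset.card_image_of_injective _ (fun b b' hb => by simpa using hb)]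
    simp
  · rw [gridCol, Finset.card_image_of_injective _ (fun b b' hb => by simpa using hb)]
    simp

theorem gridLines_eq_of_mem {L₁ L₂ : Finset (GridVertex q s t R)} (h₁ : L₁ ∈ gridLines s t R)
    (h₂ : L₂ ∈ gridLines s t R) {u v : GridVertex q s t R} (huv : u ≠ v) (hu₁ : u ∈ L₁)
    (hv₁ : v ∈ L₁) (hu₂ : u ∈ L₂) (hv₂ : v ∈ L₂) : L₁ = L₂ := by
  rcases u with ⟨i, a, b, h, e⟩ | x
  · rcases v with ⟨i', a', b', h', e'⟩ | y
    · obtain ⟨i₁, a₁, k₁, e₁, rfl | rfl⟩ := h₁ <;> obtain ⟨i₂, a₂, k₂, e₂, rfl | rfl⟩ := h₂ <;>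
      simp only [inl_mem_gridRow, inl_mem_gridCol] at hu₁ hv₁ hu₂ hv₂ <;> grind
    · exact absurd hv₁ (inr_notMem_of_mem_gridLines h₁ y)
  · exact absurd hu₁ (inr_notMem_of_mem_gridLines h₁ x)

/-- Two of the three vertices share the side `e` of the bipartite factor, hence differ in the grid.
The third cannot lie on the other side, as it would have to share the grid position of both. So the
triangle lies in a single `K_s □ K_s`, where triangles are collinear. -/
theorem exists_gridLine_of_triangle {u v w : Fin q × Fin s × Fin s × Fin t × Bool}
    (huv : (gridNetwork R P).Adj (.inl u) (.inl v)) (huw : (gridNetwork R P).Adj (.inl u) (.inl w))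
    (hvw : (gridNetwork R P).Adj (.inl v) (.inl w)) :
    ∃ L ∈ gridLines s t R, .inl u ∈ L ∧ .inl v ∈ L ∧ .inl w ∈ L := by
  obtain ⟨i, a, b, h, e⟩ := u
  obtain ⟨i', a', b', h', e'⟩ := v
  obtain ⟨i'', a'', b'', h'', e''⟩ := w
  rw [gridNetwork_adj_inl_inl] at huv huw hvw
  by_cases ha : a = a' ∧ a = a'' ∧ h = h' ∧ h = h'' ∧ e = e' ∧ e = e''
  · refine ⟨gridRow R i a h e, ⟨i, a, h, e, Or.inl rfl⟩, ?_⟩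
    simp only [inl_mem_gridRow]
    grind
  · refine ⟨gridCol R i b h e, ⟨i, b, h, e, Or.inr rfl⟩, ?_⟩
    simp only [inl_mem_gridCol]
    have hb : e = e' ∨ e = e'' ∨ e' = e'' := by
      cases e <;> cases e' <;> cases e'' <;> simp
    grind

/-- The allies of a special vertex lie over the diagonal, which a row or column meets only once. -/
theorem marked_unique_on_line {L : Finset (GridVertex q s t R)} (hL : L ∈ gridLines s t R)
    {x : R} {u v : Fin q × Fin s × Fin s × Fin t × Bool} (hu : .inl u ∈ L) (hv : .inl v ∈ L)
    (hxu : (gridNetwork R P).Adj (.inr x) (.inl u))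
    (hxv : (gridNetwork R P).Adj (.inr x) (.inl v)) : u = v := by
  obtain ⟨i, a, b, h, e⟩ := u
  obtain ⟨i', a', b', h', e'⟩ := v
  rw [gridNetwork_adj_inr_inl, Marked] at hxu hxv
  obtain ⟨i₁, a₁, k₁, e₁, rfl | rfl⟩ := hL <;>
    simp only [inl_mem_gridRow, inl_mem_gridCol] at hu hv <;> grind

/-- Special vertices are pairwise unallied, so at least three members are ordinary. Two of these
determine the line, and a special vertex cannot be allied with both. -/
theorem exists_gridLine_of_isClique {C : Finset (GridVertex q s t R)}
    (hC : (gridNetwork R P).IsClique (C : Set (GridVertex q s t R))) (h4 : 4 ≤ C.card) :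
    ∃ L ∈ gridLines s t R, C ⊆ L := by
  have hr : C.toRight.card ≤ 1 := by
    rw [Finset.card_le_one]
    intro x hx y hy
    by_contra hxy
    exact gridNetwork_adj_inr_inr (hC (Finset.mem_coe.2 (Finset.mem_toRight.1 hx))
      (Finset.mem_coe.2 (Finset.mem_toRight.1 hy)) (by simpa using hxy))
  have hl : 2 < C.toLeft.card := by
    have := Finset.card_toLeft_add_card_toRight (u := C)
    omega
  have hadj : ∀ u ∈ C.toLeft, ∀ v ∈ C.toLeft, u ≠ v →
      (gridNetwork R P).Adj (.inl u) (.inl v) := fun u hu v hv huv =>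
    hC (Finset.mem_coe.2 (Finset.mem_toLeft.1 hu)) (Finset.mem_coe.2 (Finset.mem_toLeft.1 hv))
      (by simpa using huv)
  obtain ⟨u, v, w, hu, hv, hw, huv, huw, hvw⟩ := Finset.two_lt_card_iff.1 hl
  obtain ⟨L, hL, huL, hvL, -⟩ :=
    exists_gridLine_of_triangle (hadj u hu v hv huv) (hadj u hu w hw huw) (hadj v hv w hw hvw)
  refine ⟨L, hL, fun z hz => ?_⟩
  rcases z with z | x
  · have hz' := Finset.mem_toLeft.2 hz
    by_cases hzu : z = u
    · rwa [hzu]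
    by_cases hzv : z = v
    · rwa [hzv]
    obtain ⟨L', hL', huL', hvL', hzL'⟩ := exists_gridLine_of_triangle (hadj u hu v hv huv)
      (hadj u hu z hz' (Ne.symm hzu)) (hadj v hv z hz' (Ne.symm hzv))
    rwa [gridLines_eq_of_mem hL hL' (by simpa using huv) huL hvL huL' hvL']
  · refine absurd (marked_unique_on_line (P := P) (x := x) hL huL hvL ?_ ?_) huv
    · exact hC hz (Finset.mem_coe.2 (Finset.mem_toLeft.1 hu)) (by simp)
    · exact hC hz (Finset.mem_coe.2 (Finset.mem_toLeft.1 hv)) (by simp)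

theorem card_allies_inter_gridLine_le (v : GridVertex q s t R) {L : Finset (GridVertex q s t R)}
    (hL : L ∈ gridLines s t R) (hv : v ∉ L) : (allies (gridNetwork R P) v ∩ L).card ≤ 1 := by
  rw [Finset.card_le_one]
  intro y hy z hz
  rw [Finset.mem_inter, mem_allies] at hy hz
  rcases y with ⟨i', a', b', h', e'⟩ | y
  · rcases z with ⟨i'', a'', b'', h'', e''⟩ | z
    · rcases v with ⟨i, a, b, h, e⟩ | x
      · rw [gridNetwork_adj_inl_inl] at hy hz
        obtain ⟨i₁, a₁, k₁, e₁, rfl | rfl⟩ := hL <;>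
          simp only [inl_mem_gridRow, inl_mem_gridCol] at hv hy hz <;>
          simp only [Sum.inl.injEq, Prod.mk.injEq] <;> grind
      · rw [marked_unique_on_line hL hy.2 hz.2 hy.1 hz.1]
    · exact absurd hz.2 (inr_notMem_of_mem_gridLines hL z)
  · exact absurd hy.2 (inr_notMem_of_mem_gridLines hL y)

theorem card_allies_inr (x : R) : (allies (gridNetwork R P) (.inr x)).card = 2 * P.card := by
  have : allies (gridNetwork R P) (.inr x) =
      (P ×ˢ (Finset.univ : Finset Bool)).image
        fun p => .inl ((x : Fin q), p.1.1, p.1.1, p.1.2, p.2) := by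
    ext v
    rw [mem_allies, Finset.mem_image]
    rcases v with ⟨i, a, b, h, e⟩ | y
    · rw [gridNetwork_adj_inr_inl, Marked]
      simp only [Sum.inl.injEq, Prod.mk.injEq, Finset.mem_product, Finset.mem_univ, and_true]
      constructor
      · rintro ⟨rfl, -, rfl, hP⟩
        exact ⟨((a, h), e), hP, rfl, rfl, rfl, rfl, rfl⟩
      · rintro ⟨⟨⟨a', h'⟩, e'⟩, hP, rfl, rfl, rfl, rfl, rfl⟩
        exact ⟨rfl, x.2, rfl, hP⟩
    · simpa using gridNetwork_adj_inr_inr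
  rw [this, Finset.card_image_of_injective, Finset.card_product]
  · simp [mul_comm]
  · rintro ⟨⟨a, h⟩, e⟩ ⟨⟨a', h'⟩, e'⟩ hp
    simp only [Sum.inl.injEq, Prod.mk.injEq] at hp ⊢
    tauto

/-- A marked vertex trades its matching partner for the special vertex, so its degree is the same as
that of an unmarked one. -/
theorem card_allies_inl (i : Fin q) (a b : Fin s) (h : Fin t) (e : Bool) :
    (allies (gridNetwork R P) (.inl (i, a, b, h, e))).card = 2 * (s - 1) + t := by
  -- `F` collects the allies outside the row and column: those on the other bipartite side and
  -- possibly the special vertex.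
  obtain ⟨F, hF, hFr, hFc⟩ : ∃ F : Finset (GridVertex q s t R), F.card = t ∧
      (∀ i' a' b' h' e', .inl (i', a', b', h', e') ∈ F ↔
        i = i' ∧ a = a' ∧ b = b' ∧ e ≠ e' ∧ ¬ (h = h' ∧ Marked R P i a b h)) ∧
      (∀ x : R, .inr x ∈ F ↔ i = x ∧ Marked R P i a b h) := by
    have hinj : Function.Injective
        fun h' : Fin t => (.inl (i, a, b, h', !e) : GridVertex q s t R) :=
      fun h₁ h₂ hh => by simpa using hh
    by_cases hm : Marked R P i a b h
    · refine ⟨insert (.inr ⟨i, hm.1⟩)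
        ((Finset.univ.erase h).image fun h' => .inl (i, a, b, h', !e)), ?_, ?_, ?_⟩
      · rw [Finset.card_insert_of_notMem (by simp), Finset.card_image_of_injective _ hinj,
          Finset.card_erase_add_one (Finset.mem_univ _), Finset.card_univ, Fintype.card_fin]
      · intro i' a' b' h' e'
        simp only [Finset.mem_insert, Finset.mem_image, Finset.mem_erase, Finset.mem_univ,
          reduceCtorEq, false_or, Sum.inl.injEq, Prod.mk.injEq, hm, and_true]
        constructor
        · rintro ⟨k, hk, rfl, rfl, rfl, rfl, rfl⟩
          exact ⟨rfl, rfl, rfl, by simp, Ne.symm hk⟩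
        · rintro ⟨rfl, rfl, rfl, he, hk⟩
          exact ⟨h', Ne.symm hk, rfl, rfl, rfl, rfl, by cases e <;> cases e' <;> simp_all⟩
      · intro x
        simp only [Finset.mem_insert, Finset.mem_image, Sum.inr.injEq, reduceCtorEq, and_false,
          exists_false, or_false, hm, and_true]
        rw [Subtype.ext_iff]
        exact eq_comm
    · refine ⟨Finset.univ.image fun h' => .inl (i, a, b, h', !e), ?_, ?_, ?_⟩
      · rw [Finset.card_image_of_injective _ hinj, Finset.card_univ, Fintype.card_fin]
      · intro i' a' b' h' e'
        simp only [Finset.mem_image, Finset.mem_univ, Sum.inl.injEq, Prod.mk.injEq, hm]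
        cases e <;> cases e' <;> grind
      · intro x
        simp [hm]
  set v : GridVertex q s t R := .inl (i, a, b, h, e) with hv
  have hrow : v ∈ gridRow R i a h e := by simp [hv, inl_mem_gridRow]
  have hcol : v ∈ gridCol R i b h e := by simp [hv, inl_mem_gridCol]
  have hal : allies (gridNetwork R P) v =
      ((gridRow R i a h e).erase v ∪ (gridCol R i b h e).erase v) ∪ F := by
    ext w
    rw [mem_allies, Finset.mem_union, Finset.mem_union, Finset.mem_erase, Finset.mem_erase]
    rcases w with ⟨i', a', b', h', e'⟩ | x
    · rw [hv, gridNetwork_adj_inl_inl, hFr, inl_mem_gridRow, inl_mem_gridCol]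
      simp only [ne_eq, Sum.inl.injEq, Prod.mk.injEq]
      grind
    · rw [hv, gridNetwork_adj_inl_inr, hFc]
      simp [inr_notMem_gridRow, inr_notMem_gridCol]
  have hd₁ : Disjoint ((gridRow R i a h e).erase v) ((gridCol R i b h e).erase v) := by
    rw [Finset.disjoint_left]
    rintro (⟨i', a', b', h', e'⟩ | x) h₁ h₂
    · rw [Finset.mem_erase, inl_mem_gridRow] at h₁
      rw [Finset.mem_erase, inl_mem_gridCol] at h₂
      refine h₁.1 ?_
      simp [hv, h₁.2, h₂.2]
    · exact inr_notMem_gridRow (Finset.mem_of_mem_erase h₁)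
  have hd₂ : Disjoint ((gridRow R i a h e).erase v ∪ (gridCol R i b h e).erase v) F := by
    rw [Finset.disjoint_left]
    rintro (⟨i', a', b', h', e'⟩ | x) h₁ h₂
    · rw [Finset.mem_union, Finset.mem_erase, Finset.mem_erase, inl_mem_gridRow,
        inl_mem_gridCol] at h₁
      rw [hFr] at h₂
      grind
    · simp [inr_notMem_gridRow, inr_notMem_gridCol] at h₁
  rw [hal, Finset.card_union_of_disjoint hd₂, Finset.card_union_of_disjoint hd₁, hF,
    Finset.card_erase_of_mem hrow, Finset.card_erase_of_mem hcol,
    card_of_mem_gridLines ⟨i, a, h, e, Or.inl rfl⟩, card_of_mem_gridLines ⟨i, b, h, e, Or.inr rfl⟩]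
  omega

/-- The pair `ht₁`, `ht₂` makes a line through an ordinary vertex just fail at `g` and just win
after one deletion. The pair `hP₁`, `hP₂` does so for a special vertex and a full line containing
one of its allies. -/
theorem warStable_gridNetwork {γ : ℝ} (hγ : 0 < γ) (hs : 8 ≤ s) (hs' : 1 ≤ γ * (s - 2))
    (ht₁ : (s : ℝ) - 1 ≤ γ * (s + t)) (ht₂ : γ * (s + t - 1) < (s : ℝ) - 1)
    (hP₁ : (s : ℝ) ≤ γ * (2 * P.card)) (hP₂ : γ * (2 * P.card - 1) < (s : ℝ)) :
    WarStable (Outnumbered γ) (gridNetwork R P) := by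
  have hinl : ∀ i a b h e, ((allies (gridNetwork R P) (.inl (i, a, b, h, e))).card : ℝ) =
      2 * (s - 1) + t := by
    intro i a b h e
    rw [card_allies_inl]
    push_cast [Nat.cast_sub (show 1 ≤ s by omega)]
    ring
  have hinr : ∀ x, ((allies (gridNetwork R P) (.inr x)).card : ℝ) = 2 * P.card := by
    intro x
    rw [card_allies_inr]
    push_cast
    ring
  have hs8 : (8 : ℝ) ≤ s := by exact_mod_cast hs
  refine warStable_of_lines hγ (gridLines s t R) (fun L => isClique_of_mem_gridLines)
    (fun L => card_of_mem_gridLines) (fun L₁ h₁ L₂ h₂ u v => gridLines_eq_of_mem h₁ h₂)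
    (fun C => exists_gridLine_of_isClique) ?_ (fun v L hL hv =>
      ⟨card_allies_inter_gridLine_le v hL hv, ?_⟩) ?_ ?_
  · rintro (⟨i, a, b, h, e⟩ | x)
    · rw [hinl]
      nlinarith
    · rw [hinr]
      nlinarith
  · rcases v with ⟨i, a, b, h, e⟩ | x
    · rw [hinl]
      nlinarith
    · rw [hinr]
      exact hP₁
  · rintro (⟨i, a, b, h, e⟩ | x) L hL hv
    · rw [hinl]
      nlinarith
    · exact absurd hv (inr_notMem_of_mem_gridLines hL x)
  · rintro (⟨i, a, b, h, e⟩ | x) w hadj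
    · left
      rw [hinl]
      have hlt : γ * (2 * ((s : ℝ) - 1) + t - (s - 1)) < (s : ℝ) - 1 := by
        linarith
      -- The row and the column of a vertex meet only there, so at least one of them avoids `w`.
      by_cases hw : w ∈ gridRow R i a h e
      · refine ⟨gridCol R i b h e, ⟨i, b, h, e, Or.inr rfl⟩, by simp [inl_mem_gridCol], ?_, hlt⟩
        intro hw'
        refine hadj.ne ?_
        rcases w with ⟨i', a', b', h', e'⟩ | y
        · rw [inl_mem_gridRow] at hw
          rw [inl_mem_gridCol] at hw'
          simp [hw, hw']
        · exact absurd hw inr_notMem_gridRow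
      · exact ⟨gridRow R i a h e, ⟨i, a, h, e, Or.inl rfl⟩, by simp [inl_mem_gridRow], hw, hlt⟩
    · right
      rw [hinr]
      rcases w with ⟨i, a, b, h, e⟩ | y
      -- The row through the other end of the subdivided edge avoids `w` and contains an ally of the
      -- special vertex.
      · refine ⟨gridRow R i a h (!e), ⟨i, a, h, !e, Or.inl rfl⟩, inr_notMem_gridRow,
          by simp [inl_mem_gridRow], ⟨.inl (i, a, b, h, !e), ?_⟩, hP₂⟩
        rw [Finset.mem_inter, mem_allies, inl_mem_gridRow]
        exact ⟨gridNetwork_adj_inr_inl.2 (gridNetwork_adj_inr_inl.1 hadj), rfl, rfl, rfl, rfl⟩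
      · exact absurd hadj gridNetwork_adj_inr_inr

end Construction

/-! ### Invariance under relabelling of the countries -/

section Transport

variable {V W : Type*} [Fintype V] [DecidableEq V] [Fintype W] [DecidableEq W] {γ : ℝ}

theorem outnumbered_comap {g : SimpleGraph W} (e : V ≃ W) {i : V}
    (h : Outnumbered γ g (e i)) : Outnumbered γ (g.comap e) i := by
  obtain ⟨C, hC, hi, hlt⟩ := h
  refine ⟨C.map e.symm.toEmbedding, ?_, ?_, ?_⟩
  · intro u hu v hv huv
    simp only [Finset.coe_map, Equiv.coe_toEmbedding, Equiv.image_symm_eq_preimage,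
      Set.mem_preimage, Finset.mem_coe] at hu hv
    exact hC hu hv (e.injective.ne huv)
  · simpa [Finset.mem_map_equiv] using hi
  · have : allies (g.comap e) i \ C.map e.symm.toEmbedding =
        (allies g (e i) \ C).map e.symm.toEmbedding := by
      ext v
      simp [Finset.mem_map_equiv, mem_allies]
    rwa [this, Finset.card_map, Finset.card_map]

theorem outnumbered_comap_iff {g : SimpleGraph W} (e : V ≃ W) {i : V} :
    Outnumbered γ (g.comap e) i ↔ Outnumbered γ g (e i) := by
  refine ⟨fun h => ?_, outnumbered_comap e⟩
  have h' := outnumbered_comap (g := g.comap e) (i := e i) e.symm (by simpa using h)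
  have : (g.comap e).comap e.symm = g := by
    ext u v
    simp
  rwa [this] at h'

theorem warStable_comap {g : SimpleGraph W} (e : V ≃ W) (hst : WarStable (Outnumbered γ) g) :
    WarStable (Outnumbered γ) (g.comap e) := by
  refine ⟨fun i => ?_, fun j k hjk hadj i => ?_, fun j k hadj => ?_⟩
  · rw [outnumbered_comap_iff]
    exact hst.not_vulnerable _
  · have : addAlliance (g.comap e) j k = (addAlliance g (e j) (e k)).comap e := by
      ext u v
      simp [addAlliance_adj]
    rw [this, outnumbered_comap_iff]
    exact hst.add_not_vulnerable _ _ (e.injective.ne hjk) hadj _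
  · have : deleteAlliance (g.comap e) j k = (deleteAlliance g (e j) (e k)).comap e := by
      ext u v
      simp [deleteAlliance_adj]
    rw [this, outnumbered_comap_iff, outnumbered_comap_iff]
    exact hst.delete_vulnerable _ _ hadj

end Transport

/-! ### Choice of `s`, `t` and `p` -/

section Parameters

/-- Arbitrarily large multiples of a positive real number have an even ceiling. -/
theorem exists_even_ceil {x : ℝ} (hx : 0 < x) {s₀ : ℕ} (hs₀ : 0 < s₀) :
    ∃ s p : ℕ, s₀ ≤ s ∧ s * x ≤ 2 * p ∧ (2 * p : ℝ) < s * x + 1 := by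
  have hpos : 0 < (s₀ : ℝ) * x := by positivity
  rcases Nat.even_or_odd' ⌈(s₀ : ℝ) * x⌉₊ with ⟨k, hk | hk⟩
  · have h₁ := Nat.le_ceil ((s₀ : ℝ) * x)
    have h₂ := Nat.ceil_lt_add_one hpos.le
    rw [hk] at h₁ h₂
    push_cast at h₁ h₂
    exact ⟨s₀, k, le_rfl, h₁, h₂⟩
  · have h₁ := Nat.le_ceil ((s₀ : ℝ) * x)
    have h₂ := Nat.ceil_lt_add_one hpos.le
    rw [hk] at h₁ h₂
    push_cast at h₁ h₂
    -- Here `0 < u ≤ 1`. With `m = ⌊1/u⌋`, the product `(m + 1) * u` lies in `(1, 2]`, so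
    -- multiplying `s₀` by `m + 1` makes the ceiling even.
    obtain ⟨u, hu⟩ : ∃ u : ℝ, u = s₀ * x - 2 * k := ⟨_, rfl⟩
    have hu0 : 0 < u := by linarith
    have hm₁ := Nat.floor_le (one_div_pos.2 hu0).le
    have hm₂ := Nat.lt_floor_add_one (1 / u)
    set m := ⌊1 / u⌋₊
    rw [le_div_iff₀ hu0] at hm₁
    rw [div_lt_iff₀ hu0] at hm₂
    have hs : (((m + 1) * s₀ : ℕ) : ℝ) * x = 2 * ((m + 1) * k) + (m + 1) * u := by
      rw [hu]
      push_cast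
      ring
    refine ⟨(m + 1) * s₀, (m + 1) * k + 1, Nat.le_mul_of_pos_left _ (by omega), ?_, ?_⟩
    · rw [hs]
      push_cast
      linarith
    · rw [hs]
      push_cast
      linarith

/-- The choices are `s + t = ⌈(s-1)/γ⌉` and `2p = ⌈s/γ⌉`; the second requires an even ceiling
because special vertices gain allies in pairs. -/
theorem exists_parameters {γ : ℝ} (hγ : 0 < γ) (hγ1 : γ < 1) : ∃ s t p : ℕ,
    8 ≤ s ∧ 1 ≤ t ∧ p ≤ s * t ∧ 1 ≤ γ * (s - 2) ∧ (s : ℝ) - 1 ≤ γ * (s + t) ∧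
      γ * (s + t - 1) < (s : ℝ) - 1 ∧ (s : ℝ) ≤ γ * (2 * p) ∧ γ * (2 * p - 1) < (s : ℝ) := by
  -- `a` secures `1 ≤ γ(s - 2)`. `b` secures `(1 - γ)s ≥ 2`, hence `γt ≥ 1`, which leaves room for
  -- `p ≤ st`.
  obtain ⟨a, ha⟩ := exists_nat_ge (1 / γ)
  obtain ⟨b, hb⟩ := exists_nat_ge (2 / (1 - γ))
  rw [div_le_iff₀ hγ] at ha
  rw [div_le_iff₀ (by linarith)] at hb
  obtain ⟨s, p, hs, hp₁, hp₂⟩ :=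
    exists_even_ceil (one_div_pos.2 hγ) (show 0 < 8 + a + b by omega)
  rw [mul_one_div] at hp₁ hp₂
  have hs' : (8 : ℝ) + a + b ≤ s := by exact_mod_cast hs
  have ha0 : (0 : ℝ) ≤ a := a.cast_nonneg
  have hb0 : (0 : ℝ) ≤ b := b.cast_nonneg
  have hp₁' : (s : ℝ) ≤ γ * (2 * p) := by
    rw [div_le_iff₀ hγ] at hp₁
    linarith
  have hp₂' : γ * (2 * p - 1) < (s : ℝ) := by
    rw [← sub_lt_iff_lt_add, lt_div_iff₀ hγ] at hp₂
    linarith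
  have hpos : 0 < ((s : ℝ) - 1) / γ := div_pos (by linarith) hγ
  have hc₁ := Nat.le_ceil (((s : ℝ) - 1) / γ)
  have hc₂ := Nat.ceil_lt_add_one hpos.le
  set c := ⌈((s : ℝ) - 1) / γ⌉₊
  rw [div_le_iff₀ hγ] at hc₁
  rw [← sub_lt_iff_lt_add, lt_div_iff₀ hγ] at hc₂
  have hsc : s ≤ c := by
    by_contra! h
    have h' : (c : ℝ) + 1 ≤ s := by exact_mod_cast h
    nlinarith
  obtain ⟨t, hct⟩ := Nat.exists_eq_add_of_le hsc
  rw [hct] at hc₁ hc₂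
  push_cast at hc₁ hc₂
  have ht : 1 ≤ γ * t := by nlinarith
  have ht1 : 1 ≤ t := by
    by_contra! h
    obtain rfl : t = 0 := by omega
    simp at ht
    linarith
  refine ⟨s, t, p, by omega, ht1, ?_, by nlinarith, by linarith, by linarith, hp₁', hp₂'⟩
  by_contra! h
  have h' : (s : ℝ) * t ≤ p := by exact_mod_cast h.le
  nlinarith [mul_le_mul_of_nonneg_left h' hγ.le]

end Parameters

theorem exists_warStable_ne_bot {γ : ℝ} (hγ : 0 < γ) (hγ1 : γ < 1) :
    ∃ n₀ : ℕ, ∀ n : ℕ, n₀ ≤ n →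
      ∃ g : SimpleGraph (Fin n), g ≠ ⊥ ∧ WarStable (Outnumbered γ) g := by
  obtain ⟨s, t, p, hs, ht, hp, hs', ht₁, ht₂, hp₁, hp₂⟩ := exists_parameters hγ hγ1
  obtain ⟨P, -, rfl⟩ : ∃ P ⊆ (Finset.univ : Finset (Fin s × Fin t)), P.card = p :=
    Finset.exists_subset_card_eq (by simpa using hp)
  -- `N` is the size of a block. For `n ≥ N * N` there are `n / N ≥ N > n % N` blocks, enough to
  -- attach one special vertex for each unit of the remainder.
  set N := s * (s * (t * 2)) with hN
  have hN0 : 0 < N := by positivity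
  refine ⟨N * N, fun n hn => ?_⟩
  have hq : N ≤ n / N := (Nat.le_div_iff_mul_le hN0).2 hn
  obtain ⟨R, -, hR⟩ : ∃ R ⊆ (Finset.univ : Finset (Fin (n / N))), R.card = n % N :=
    Finset.exists_subset_card_eq (by simpa using (Nat.mod_lt n hN0).le.trans hq)
  have hcard : Fintype.card (Fin n) = Fintype.card (GridVertex (n / N) s t R) := by
    simp only [Fintype.card_fin, Fintype.card_sum, Fintype.card_prod, Fintype.card_bool,
      Fintype.card_coe, hR]
    rw [← hN, Nat.div_add_mod']
  let e := Fintype.equivOfCardEq hcard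
  refine ⟨(gridNetwork R P).comap e, ?_,
    warStable_comap e (warStable_gridNetwork hγ hs hs' ht₁ ht₂ hp₁ hp₂)⟩
  intro hbot
  let u : Fin s → GridVertex (n / N) s t R :=
    fun a => .inl (⟨0, hN0.trans_le hq⟩, ⟨0, by omega⟩, a, ⟨0, by omega⟩, true)
  have hadj : (gridNetwork R P).Adj (u ⟨0, by omega⟩) (u ⟨1, by omega⟩) := by
    rw [gridNetwork_adj_inl_inl]
    simp
  have : ((gridNetwork R P).comap e).Adj (e.symm (u ⟨0, by omega⟩)) (e.symm (u ⟨1, by omega⟩)) := by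
    simpa using hadj
  rw [hbot] at this
  exact this

end AllianceNetwork

theorem theorem2 :
    -- NC-vulnerability, for arbitrary strengths and advantages
    (∀ n : ℕ, 3 ≤ n →
      ∀ (M : Finset (Fin n) → ℝ) (γ : Finset (Fin n) → Finset (Fin n) → ℝ),
        AllianceNetwork.IsWarTechnology M γ →
          (¬ ∃ g : SimpleGraph (Fin n), g ≠ ⊥ ∧ AllianceNetwork.NCWarStable M γ g) ∧
          (AllianceNetwork.NCWarStable M γ ⊥ ↔
            ∀ i j k : Fin n, i ≠ j → i ≠ k → j ≠ k → M {j, k} ≤ γ {j, k} {i} * M {i})) ∧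
    -- CN-vulnerability, for equal strengths `Mbar` and constant `γ`
    (∀ n : ℕ, 3 ≤ n → ∀ Mbar γ : ℝ, 0 < Mbar →
      (1 ≤ γ → γ < 2 → ¬ ∃ g : SimpleGraph (Fin n),
        AllianceNetwork.CNWarStable
          (AllianceNetwork.additiveStrength (fun _ => Mbar)) (fun _ _ => γ) g) ∧
      (2 ≤ γ → ∀ g : SimpleGraph (Fin n),
        AllianceNetwork.CNWarStable
          (AllianceNetwork.additiveStrength (fun _ => Mbar)) (fun _ _ => γ) g ↔ g = ⊥)) ∧
    (∀ γ : ℝ, 0 < γ → γ < 1 → ∃ n₀ : ℕ, ∀ n : ℕ, n₀ ≤ n → ∀ Mbar : ℝ, 0 < Mbar →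
      ∃ g : SimpleGraph (Fin n), g ≠ ⊥ ∧
        AllianceNetwork.CNWarStable
          (AllianceNetwork.additiveStrength (fun _ => Mbar)) (fun _ _ => γ) g) := by
  refine ⟨fun n hn M γ hT => ⟨?_, ?_⟩, fun n hn m γ hm => ⟨?_, ?_⟩, fun γ hγ hγ1 => ?_⟩
  · rintro ⟨g, hg, hst⟩
    exact AllianceNetwork.not_ncWarStable_of_ne_bot hT hg hst
  · exact AllianceNetwork.ncWarStable_bot_iff hT (by simpa using hn)
  · rintro hγ1 hγ2 ⟨g, hst⟩
    rw [AllianceNetwork.cnWarStable_iff hm (by linarith)] at hst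
    obtain rfl := AllianceNetwork.eq_bot_of_warStable hγ1 hst
    exact AllianceNetwork.not_warStable_bot (by simpa using hn) hγ2 hst
  · intro hγ g
    rw [AllianceNetwork.cnWarStable_iff hm (by linarith)]
    refine ⟨AllianceNetwork.eq_bot_of_warStable (by linarith), ?_⟩
    rintro rfl
    exact AllianceNetwork.warStable_bot hγ
  · obtain ⟨n₀, hn₀⟩ := AllianceNetwork.exists_warStable_ne_bot hγ hγ1
    refine ⟨n₀, fun n hn m hm => ?_⟩
    obtain ⟨g, hg, hst⟩ := hn₀ n hn
    exact ⟨g, hg, (AllianceNetwork.cnWarStable_iff hm hγ g).2 hst⟩
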